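/- Let $p$ be a prime and let $R$ be a pro-$p$ domain, i.e. a Noetherian local integral domain that is complete with respect to its maximal ideal $\mathfrak m$ and has finite residue field of characteristic $p$; give $R$ the $\mathfrak m$-adic topology. A map between open subsets of $R^{(n)}$ and $R^{(m)}$ is $R$-analytic if around every point $v$ it has the form $v+x\mapsto \mathbf F(x)$, $x\in(\mathfrak m^N)^{(n)}$, for some $N$ and some tuple $\mathbf F$ of power series with coefficients in $R$ converging there. An $R$-analytic group of dimension $d$ is a topological group $G$ with an atlas of charts onto open subsets of $R^{(d)}$ with $R$-analytic coordinate changes, for which multiplication and inversion are $R$-analytic. An $R$-standard subgroup $(H,\phi)$ of level $N\ge 1$ of $G$ is an open subgroup $H$ with a homeomorphism $\phi\colon H\to(\mathfrak m^N)^{(d)}$ which is a chart compatible with the atlas of $G$, such that $\phi(1)=\mathbf 0$ and such that there are power series $F_1,\dots,F_d\in R[[X_1,\dots,X_{2d}]]$ with zero constant term satisfying $\phi(xy)=(F_1(\phi(x),\phi(y)),\dots,F_d(\phi(x),\phi(y)))$ for all $x,y\in H$. Let $G$ be a compact $R$-analytic group of dimension $d$, and let $S$ be an open normal $R$-standard subgroup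 of $G$ obtained by the following construction. Take an $R$-standard subgroup $(H,\phi)$ of $G$ of level $N$ and a left transversal $T$ for $H$ in $G$. For each $t\in T$ take $N_t\ge N$ and a tuple $\mathbf C^t\in R[[X_1,\dots,X_d]]^{(d)}$ such that for all $x\in\phi^{-1}((\mathfrak m^{N_t})^{(d)})$ one has $x^t:=t^{-1}xt\in H$ and $\phi(x^t)=\mathbf C^t(\phi(x))$. Put $L=\max_{t\in T}N_t$ and $S=\phi^{-1}((\mathfrak m^L)^{(d)})$. Let $w$ be a word in $k$ variables, i.e. an element of the free group on $x_1,\dots,x_k$, and suppose that its set of values $w\{G\}=\{w(g_1,\dots,g_k)\mid g_i\in G\}$ is finite. Then $S$ is marginal for $w$: every $s\in S$ satisfies $w(g_1,\dots,sg_i,\dots,g_k)=w(g_1,\dots,g_k)$ for all $g_1,\dots,g_k\in G$ and all $i$. Moreover, $w(x_1,\dots,x_k)=w(y_1,\dots,y_k)$ for all $x_i,y_i\in G$ with $x_iy_i^{-1}\in S$ $(1\le i\le k)$; equivalently, $w$ is constant on every product $t_1S\times\dots\times t_kS$ of cosets of $S$. -/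

import Mathlib

/-! ### Pro-`p` domains -/

/-- `R` is a pro-`p` domain: a Noetherian local integral domain, complete (and separated) for its
maximal ideal `𝔪`, with finite residue field of characteristic `p`; it carries the `𝔪`-adic
topology. -/
class IsProPDomain (p : ℕ) (R : Type*) [CommRing R] [IsLocalRing R] [TopologicalSpace R] :
    Prop where
  prime : p.Prime
  isDomain : IsDomain R
  isNoetherianRing : IsNoetherianRing R
  isAdicComplete : IsAdicComplete (IsLocalRing.maximalIdeal R) R
  finite_residueField : Finite (IsLocalRing.ResidueField R)
  charP_residueField : CharP (IsLocalRing.ResidueField R) p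
  isAdic : IsAdic (IsLocalRing.maximalIdeal R)

/-- The subset `(𝔪 ^ N)^(σ)` of `R^(σ)`. -/
def maxIdealPowBox (R : Type*) [CommRing R] [IsLocalRing R] (σ : Type*) (N : ℕ) : Set (σ → R) :=
  {x | ∀ i, x i ∈ IsLocalRing.maximalIdeal R ^ N}

/-! ### Power series and analytic maps -/

/-- The power series `F` converges at the point `x`, with value `F(x) = y`. -/
def PowerSeriesEvalsTo {R : Type*} [CommRing R] [TopologicalSpace R] {σ : Type*}
    (F : MvPowerSeries σ R) (x : σ → R) (y : R) : Prop :=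
  HasSum (fun n : σ →₀ ℕ => MvPowerSeries.coeff n F * n.prod fun i e => x i ^ e) y

/-- `f` is `R`-analytic on the (necessarily open) set `V ⊆ R^(σ)`: around each point `v` of `V`
it is given by power series with coefficients in `R`, that is `f (v + x) = F(x)` for all
`x ∈ (𝔪 ^ N)^(σ)`, for some `N`. -/
def IsRAnalyticOn {R : Type*} [CommRing R] [IsLocalRing R] [TopologicalSpace R] {σ τ : Type*}
    (f : (σ → R) → (τ → R)) (V : Set (σ → R)) : Prop :=
  ∀ v ∈ V, ∃ (N : ℕ) (F : τ → MvPowerSeries σ R), ∀ x ∈ maxIdealPowBox R σ N,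
    v + x ∈ V ∧ ∀ j, PowerSeriesEvalsTo (F j) x (f (v + x) j)

/-- Two charts with values in `R^(d)` are compatible: both coordinate changes are `R`-analytic. -/
def RAnalyticCompatible {R : Type*} [CommRing R] [IsLocalRing R] [TopologicalSpace R] {d : ℕ}
    {M : Type*} [TopologicalSpace M] (e e' : OpenPartialHomeomorph M (Fin d → R)) : Prop :=
  IsRAnalyticOn (fun z => e' (e.symm z)) {z | z ∈ e.target ∧ e.symm z ∈ e'.source} ∧
  IsRAnalyticOn (fun z => e (e'.symm z)) {z | z ∈ e'.target ∧ e'.symm z ∈ e.source}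

/-- `M` is an `R`-analytic manifold of dimension `d`: the charts of its atlas, which are
homeomorphisms from open subsets covering `M` onto open subsets of `R^(d)`, are pairwise
compatible. -/
class RAnalyticManifold (R : Type*) [CommRing R] [IsLocalRing R] [TopologicalSpace R] (d : ℕ)
    (M : Type*) [TopologicalSpace M] [ChartedSpace (Fin d → R) M] : Prop where
  compatible : ∀ e ∈ atlas (Fin d → R) M, ∀ e' ∈ atlas (Fin d → R) M, RAnalyticCompatible e e'

/-- `G` is an `R`-analytic group of dimension `d`: a topological group and an `R`-analytic
manifold, whose multiplication and inversion are `R`-analytic when read in charts. -/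
class RAnalyticGroup (R : Type*) [CommRing R] [IsLocalRing R] [TopologicalSpace R] (d : ℕ)
    (G : Type*) [Group G] [TopologicalSpace G] [ChartedSpace (Fin d → R) G] : Prop
    extends RAnalyticManifold R d G where
  isTopologicalGroup : IsTopologicalGroup G
  analytic_mul : ∀ e₁ ∈ atlas (Fin d → R) G, ∀ e₂ ∈ atlas (Fin d → R) G,
    ∀ e₃ ∈ atlas (Fin d → R) G,
    IsRAnalyticOn
      (fun z : Fin d ⊕ Fin d → R => e₃ (e₁.symm (z ∘ Sum.inl) * e₂.symm (z ∘ Sum.inr)))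
      {z | z ∘ Sum.inl ∈ e₁.target ∧ z ∘ Sum.inr ∈ e₂.target ∧
        e₁.symm (z ∘ Sum.inl) * e₂.symm (z ∘ Sum.inr) ∈ e₃.source}
  analytic_inv : ∀ e₁ ∈ atlas (Fin d → R) G, ∀ e₂ ∈ atlas (Fin d → R) G,
    IsRAnalyticOn (fun z => e₂ (e₁.symm z)⁻¹) {z | z ∈ e₁.target ∧ (e₁.symm z)⁻¹ ∈ e₂.source}

/-! ### Standard subgroups -/

/-- `(H, φ)` is an `R`-standard subgroup of level `N` of the `R`-analytic group `G`: the subgroup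
`H` is open, `φ` is a homeomorphism from `H` onto `(𝔪 ^ N)^(d)` which is a chart for the analytic
structure of `G`, `φ 1 = 0`, and in the coordinates `φ` the multiplication of `H` is given by
power series over `R` with zero constant term. -/
structure IsRStandardSubgroup {R : Type*} [CommRing R] [IsLocalRing R] [TopologicalSpace R] {d : ℕ}
    {G : Type*} [Group G] [TopologicalSpace G] [ChartedSpace (Fin d → R) G]
    (H : Subgroup G) (φ : OpenPartialHomeomorph G (Fin d → R)) (N : ℕ) : Prop where
  level_pos : 1 ≤ N
  source_eq : φ.source = (H : Set G)
  target_eq : φ.target = maxIdealPowBox R (Fin d) N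
  compatible : ∀ e ∈ atlas (Fin d → R) G, RAnalyticCompatible φ e
  map_one : φ 1 = 0
  exists_mul_series : ∃ F : Fin d → MvPowerSeries (Fin d ⊕ Fin d) R,
    (∀ j, MvPowerSeries.constantCoeff (F j) = 0) ∧
    ∀ x ∈ H, ∀ y ∈ H, ∀ j, PowerSeriesEvalsTo (F j) (Sum.elim (φ x) (φ y)) (φ (x * y) j)

/-- `S` arises by the following construction, which produces open normal `R`-standard subgroups.
Take an `R`-standard subgroup `(H, φ)` of `G`, of level `N`, and a left transversal `T` for `H` in
`G`. For each `t ∈ T` take `n t ≥ N` such that on `φ⁻¹((𝔪 ^ n t)^(d))` the conjugation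
`x ↦ x ^ t = t⁻¹ * x * t` takes values in `H` and is given by a tuple `C` of power series over `R`
in the coordinates `φ`. Let `L` be the maximum of the `n t`; then `S = φ⁻¹((𝔪 ^ L)^(d))`. -/
def IsConstructedNormalStandard (R : Type*) [CommRing R] [IsLocalRing R] [TopologicalSpace R]
    (d : ℕ) {G : Type*} [Group G] [TopologicalSpace G] [ChartedSpace (Fin d → R) G]
    (S : Subgroup G) : Prop :=
  ∃ (H : Subgroup G) (φ : OpenPartialHomeomorph G (Fin d → R)) (N : ℕ) (T : Set G) (n : G → ℕ)
    (L : ℕ),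
    IsRStandardSubgroup H φ N ∧
    Subgroup.IsComplement T (H : Set G) ∧
    (∀ t ∈ T, N ≤ n t ∧ ∃ C : Fin d → MvPowerSeries (Fin d) R,
      ∀ x ∈ H, φ x ∈ maxIdealPowBox R (Fin d) (n t) →
        t⁻¹ * x * t ∈ H ∧ ∀ j, PowerSeriesEvalsTo (C j) (φ x) (φ (t⁻¹ * x * t) j)) ∧
    IsGreatest (n '' T) L ∧
    (S : Set G) = {x | x ∈ H ∧ φ x ∈ maxIdealPowBox R (Fin d) L}

/-! ### Words -/

/-- The word map `G^(k) → G` of the word `w`. -/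
def wordMap {k : ℕ} (w : FreeGroup (Fin k)) (G : Type*) [Group G] (x : Fin k → G) : G :=
  FreeGroup.lift x w

/-- The set `w{G}` of word-values. -/
def wordValues {k : ℕ} (w : FreeGroup (Fin k)) (G : Type*) [Group G] : Set G :=
  Set.range (wordMap w G)

/-- The marginal subgroup `w*(G)`: the elements `g` such that replacing any one `x i` by
`g * x i` does not change `w(x_1, …, x_k)`. -/
def marginalSubgroup {k : ℕ} (w : FreeGroup (Fin k)) (G : Type*) [Group G] : Subgroup G where
  carrier := {g | ∀ (x : Fin k → G) (i : Fin k),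
    wordMap w G (Function.update x i (g * x i)) = wordMap w G x}
  one_mem' := fun x i => by simp
  mul_mem' := fun {a b} ha hb x i => by
    have h := ha (Function.update x i (b * x i)) i
    simp only [Function.update_self, Function.update_idem] at h
    rw [mul_assoc, h, hb]
  inv_mem' := fun {a} ha x i => by
    have h := ha (Function.update x i (a⁻¹ * x i)) i
    simp only [Function.update_self, Function.update_idem, mul_inv_cancel_left,
      Function.update_eq_self] at h
    exact h.symm

/-! ### Power series over an adic ring and the finite-values principle. -/

section PowerSeries

open MvPowerSeries IsLocalRing Filter
open scoped MvPowerSeries.WithPiTopology Topology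

variable {R : Type*} [CommRing R] [IsLocalRing R]

/-! Fix `t` and let `s` range over `k`-tuples in `S`, parametrized through `φ` by points `z` of the
box `(𝔪 ^ L)^(kd)`. The map `z ↦ w(t)⁻¹ w(t₁s₁(z), …, t_k s_k(z))` takes finitely many values, and
the claim is that it is given by power series in the coordinates `φ`. A power series with finitely
many values on the box is constant (`eq_of_powerSeriesEvalsTo_of_finite`), so the map equals its
value at `z = 0`, which is `1`.

Analyticity: `w(t)⁻¹ w(ts)` is a product of conjugates of the `sᵢ^{±1}` (`wordMap_mul_mem`), so it
is enough that the power series maps into `S` form a group stable under conjugation by `G`. Products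
come from substitution into the multiplication series, conjugates from the series `C` of the
construction, and inverses from compactness: an inverse is a limit point of positive powers
(`IsPowerSeriesMap.inv`).

Constancy: restricting to lines reduces to one variable. If `u` takes values in a finite set `s`,
then `∏ (u - c)` over `c ∈ s` vanishes on `𝔪`, hence is zero, and `u` equals some `c` because `R⟦X⟧`
is a domain. -/

theorem maxIdealPowBox_zero_mem (σ : Type*) (N : ℕ) : (0 : σ → R) ∈ maxIdealPowBox R σ N :=
  fun _ => zero_mem _

theorem maxIdealPowBox_anti {σ : Type*} {M N : ℕ} (h : M ≤ N) :
    maxIdealPowBox R σ N ⊆ maxIdealPowBox R σ M :=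
  fun _ hx i => Ideal.pow_le_pow_right h (hx i)

theorem mem_maximalIdeal_of_mem_pow {N : ℕ} (hN : 1 ≤ N) {x : R} (hx : x ∈ maximalIdeal R ^ N) :
    x ∈ maximalIdeal R :=
  Ideal.pow_le_self (by omega) hx

omit [IsLocalRing R] in
theorem isLinearTopology_of_isAdic [TopologicalSpace R] {I : Ideal R} (hI : IsAdic I) :
    IsLinearTopology R R :=
  IsLinearTopology.mk_of_hasBasis R hI.hasBasis_nhds_zero

omit [IsLocalRing R] in
theorem isTopologicalRing_of_isAdic [TopologicalSpace R] {I : Ideal R} (hI : IsAdic I) :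
    IsTopologicalRing R := by
  cases hI
  exact (RingSubgroupsBasis.toRingFilterBasis _).isTopologicalRing

omit [IsLocalRing R] in
theorem isTopologicallyNilpotent_of_mem [TopologicalSpace R] {I : Ideal R} (hI : IsAdic I)
    {x : R} (hx : x ∈ I) : IsTopologicallyNilpotent x := by
  rw [IsTopologicallyNilpotent, hI.hasBasis_nhds_zero.tendsto_right_iff]
  intro n _
  filter_upwards [eventually_ge_atTop n] with m hm
  exact Ideal.pow_le_pow_right hm (Ideal.pow_mem_pow hx m)

omit [IsLocalRing R] in
theorem isClosed_pow_of_isAdic [TopologicalSpace R] {I : Ideal R} (hI : IsAdic I) (n : ℕ) :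
    IsClosed ((I ^ n : Ideal R) : Set R) := by
  have := isTopologicalRing_of_isAdic hI
  exact AddSubgroup.isClosed_of_isOpen (I ^ n).toAddSubgroup ((isAdic_iff.1 hI).1 n)

/-- Each quotient `R ⧸ 𝔪 ^ n` is finite, so `R` is totally bounded as well as complete. -/
theorem compactSpace_of_isAdic [UniformSpace R] [IsUniformAddGroup R] [CompleteSpace R]
    [IsNoetherianRing R] [Finite (ResidueField R)] (hI : IsAdic (maximalIdeal R)) :
    CompactSpace R := by
  rw [← isCompact_univ_iff, isCompact_iff_totallyBounded_isComplete]
  refine ⟨?_, completeSpace_iff_isComplete_univ.1 inferInstance⟩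
  have hb := hI.hasBasis_nhds_zero.uniformity_of_nhds_zero
  rw [hb.totallyBounded_iff]
  intro n _
  have : Finite (R ⧸ maximalIdeal R) := ‹Finite (ResidueField R)›
  have := Ideal.finite_quotient_pow (IsNoetherian.noetherian (maximalIdeal R)) n
  refine ⟨Set.range (Quotient.out : (R ⧸ maximalIdeal R ^ n) → R), Set.finite_range _, ?_⟩
  intro x _
  refine Set.mem_iUnion₂.2 ⟨_, ⟨Ideal.Quotient.mk _ x, rfl⟩, ?_⟩
  show _ - _ ∈ maximalIdeal R ^ n
  rw [← Ideal.Quotient.eq]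
  exact Quotient.out_eq _

variable [UniformSpace R] {σ τ : Type*}

theorem hasEval_of_mem_maximalIdeal [Finite σ] (hI : IsAdic (maximalIdeal R)) {x : σ → R}
    (hx : ∀ i, x i ∈ maximalIdeal R) : HasEval x :=
  ⟨fun i => isTopologicallyNilpotent_of_mem hI (hx i), by simp [cofinite_eq_bot]⟩

theorem hasEval_of_constantCoeff_mem [Finite σ] (hI : IsAdic (maximalIdeal R))
    {a : σ → MvPowerSeries τ R} (ha : ∀ i, constantCoeff (a i) ∈ maximalIdeal R) :
    HasEval a :=
  have := isLinearTopology_of_isAdic hI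
  ⟨fun i => LinearTopology.isTopologicallyNilpotent_of_constantCoeff
    (isTopologicallyNilpotent_of_mem hI (ha i)), by simp [cofinite_eq_bot]⟩

theorem powerSeriesEvalsTo_zero_iff [T2Space R] {F : MvPowerSeries σ R} {y : R} :
    PowerSeriesEvalsTo F 0 y ↔ constantCoeff F = y := by
  have h : HasSum (fun n : σ →₀ ℕ => coeff n F * n.prod fun i e => (0 : σ → R) i ^ e)
      (constantCoeff F) := by
    convert hasSum_single (0 : σ →₀ ℕ) ?_ using 1
    · simp
    · intro n hn
      obtain ⟨i, hi⟩ := Finsupp.ne_iff.1 hn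
      rw [Finsupp.prod, Finset.prod_eq_zero (i := i) (by simpa using hi), mul_zero]
      simpa using hi
  exact ⟨fun H => h.unique H, fun H => H ▸ h⟩

/-- Every nonconstant monomial has a factor in the ideal `𝔪 ^ N`, which is closed and so contains
the sum. -/
theorem PowerSeriesEvalsTo.mem_pow (hI : IsAdic (maximalIdeal R)) {N : ℕ}
    {F : MvPowerSeries σ R} (hF : constantCoeff F ∈ maximalIdeal R ^ N) {x : σ → R}
    (hx : x ∈ maxIdealPowBox R σ N) {y : R} (h : PowerSeriesEvalsTo F x y) :
    y ∈ maximalIdeal R ^ N := by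
  refine (isClosed_pow_of_isAdic hI N).mem_of_tendsto h (Eventually.of_forall fun s => ?_)
  refine Ideal.sum_mem _ fun n _ => ?_
  by_cases hn : n = 0
  · subst hn; simpa using hF
  · obtain ⟨i, hi⟩ := Finsupp.ne_iff.1 hn
    refine Ideal.mul_mem_left _ _ (Ideal.mem_of_dvd _ (Finset.dvd_prod_of_mem _ (a := i) ?_) ?_)
    · simpa using hi
    · exact Ideal.pow_mem_of_mem _ (hx i) _ (Nat.pos_of_ne_zero hi)

variable [IsUniformAddGroup R] [IsTopologicalRing R] [IsLinearTopology R R] [T2Space R]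
  [CompleteSpace R]

omit [IsLocalRing R] in
theorem powerSeriesEvalsTo_iff {x : σ → R} (hx : HasEval x) {F : MvPowerSeries σ R} {y : R} :
    PowerSeriesEvalsTo F x y ↔ aeval (R := R) hx F = y :=
  ⟨fun h => (hasSum_aeval hx F).unique h, fun h => h ▸ hasSum_aeval hx F⟩

/-- Evaluation at `z` is a continuous algebra map, so it commutes with substituting `a` into `F`. -/
theorem PowerSeriesEvalsTo.subst [Finite σ] [Finite τ] (hI : IsAdic (maximalIdeal R))
    {F : MvPowerSeries σ R} {x : σ → R} {y : R} (h : PowerSeriesEvalsTo F x y)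
    {a : σ → MvPowerSeries τ R} (ha : ∀ i, constantCoeff (a i) ∈ maximalIdeal R) {z : τ → R}
    (hz : ∀ i, z i ∈ maximalIdeal R) (haz : ∀ i, PowerSeriesEvalsTo (a i) z (x i)) :
    PowerSeriesEvalsTo (aeval (R := R) (hasEval_of_constantCoeff_mem hI ha) F) z y := by
  have hz' := hasEval_of_mem_maximalIdeal hI hz
  have hc := continuous_aeval (R := R) hz'
  rw [powerSeriesEvalsTo_iff hz']
  have h1 := comp_aeval (R := R) (hasEval_of_constantCoeff_mem hI ha) hc
  have h2 := DFunLike.congr_fun h1 F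
  rw [AlgHom.comp_apply] at h2
  rw [h2]
  have h3 : (fun i => aeval (R := R) hz' (a i)) = x :=
    funext fun i => (powerSeriesEvalsTo_iff hz').1 (haz i)
  have h4 := (hasEval_of_constantCoeff_mem hI ha).map hc
  subst h3
  exact (powerSeriesEvalsTo_iff h4).1 h

theorem powerSeriesEvalsTo_C [Finite σ] (hI : IsAdic (maximalIdeal R)) {x : σ → R}
    (hx : ∀ i, x i ∈ maximalIdeal R) (c : R) : PowerSeriesEvalsTo (C c) x c := by
  rw [powerSeriesEvalsTo_iff (hasEval_of_mem_maximalIdeal hI hx)]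
  exact AlgHom.commutes _ c

theorem powerSeriesEvalsTo_X [Finite σ] (hI : IsAdic (maximalIdeal R)) {x : σ → R}
    (hx : ∀ i, x i ∈ maximalIdeal R) (i : σ) : PowerSeriesEvalsTo (X i) x (x i) := by
  rw [powerSeriesEvalsTo_iff (hasEval_of_mem_maximalIdeal hI hx)]
  simpa using aeval_coe (R := R) (hasEval_of_mem_maximalIdeal hI hx) (MvPolynomial.X i)

/-- Evaluation of one-variable power series at an element of the maximal ideal. -/
noncomputable def evalAt (hI : IsAdic (maximalIdeal R)) (l : maximalIdeal R) :
    PowerSeries R →ₐ[R] R :=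
  aeval (σ := Unit) (a := fun _ => (l : R)) (hasEval_of_mem_maximalIdeal hI fun _ => l.2)

theorem powerSeriesEvalsTo_iff_evalAt (hI : IsAdic (maximalIdeal R)) (l : maximalIdeal R)
    {u : PowerSeries R} {y : R} :
    PowerSeriesEvalsTo u (fun _ : Unit => (l : R)) y ↔ evalAt hI l u = y :=
  powerSeriesEvalsTo_iff _

theorem evalAt_C (hI : IsAdic (maximalIdeal R)) (l : maximalIdeal R) (c : R) :
    evalAt hI l (PowerSeries.C c) = c :=
  AlgHom.commutes _ c

theorem evalAt_X (hI : IsAdic (maximalIdeal R)) (l : maximalIdeal R) :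
    evalAt hI l PowerSeries.X = l :=
  (powerSeriesEvalsTo_iff_evalAt hI l).1 (powerSeriesEvalsTo_X hI (fun _ => l.2) ())

/-- A one-variable power series vanishing on a nonzero maximal ideal is zero. -/
theorem eq_zero_of_evalAt_eq_zero [IsDomain R] [IsHausdorff (maximalIdeal R) R]
    (hI : IsAdic (maximalIdeal R)) {π : R} (hπ : π ∈ maximalIdeal R) (hπ0 : π ≠ 0)
    {v : PowerSeries R} (hv : ∀ l, evalAt hI l v = 0) : v = 0 := by
  by_contra hv0
  obtain ⟨u, hu⟩ := PowerSeries.X_pow_order_dvd (φ := v)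
  have hu0 : PowerSeries.constantCoeff u ≠ 0 := by
    have h := PowerSeries.coeff_order hv0
    rw [congrArg (PowerSeries.coeff v.order.toNat) hu] at h
    simpa [PowerSeries.coeff_X_pow_mul'] using h
  obtain ⟨u', hu'⟩ := PowerSeries.X_dvd_iff.2
    (show PowerSeries.constantCoeff (u - PowerSeries.C (PowerSeries.constantCoeff u)) = 0 by simp)
  refine hu0 (IsHausdorff.haus ‹IsHausdorff (maximalIdeal R) R› _ fun n => ?_)
  rw [smul_eq_mul, Ideal.mul_top, SModEq.zero]
  -- Evaluate at `l = π ^ (n + 1)`, nonzero and in `𝔪` even for `n = 0`. Cancelling the power of `l`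
  -- leaves `u(l) = 0`, so the constant term of `u` is `-u'(l) * l`, which lies in `𝔪 ^ n`.
  have hl : π ^ (n + 1) ∈ maximalIdeal R := Ideal.pow_mem_of_mem _ hπ _ n.succ_pos
  have h0 := hv ⟨_, hl⟩
  rw [hu, map_mul, map_pow, evalAt_X, mul_eq_zero,
    or_iff_right (pow_ne_zero _ (pow_ne_zero _ hπ0)),
    ← sub_add_cancel u (PowerSeries.C (PowerSeries.constantCoeff u)), hu', map_add, map_mul,
    evalAt_X, evalAt_C, add_eq_zero_iff_neg_eq] at h0
  rw [← h0]
  exact neg_mem (Ideal.mul_mem_right _ _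
    (Ideal.pow_le_pow_right n.le_succ (Ideal.pow_mem_pow hπ _)))

/-- A one-variable power series with finitely many values on the maximal ideal is constant
there. -/
theorem evalAt_eq_of_finite [IsDomain R] [IsHausdorff (maximalIdeal R) R]
    (hI : IsAdic (maximalIdeal R)) (u : PowerSeries R) {s : Set R} (hs : s.Finite)
    (hu : ∀ l, evalAt hI l u ∈ s) (l m : maximalIdeal R) : evalAt hI l u = evalAt hI m u := by
  by_cases h0 : ∃ π ∈ maximalIdeal R, π ≠ 0
  · obtain ⟨π, hπ, hπ0⟩ := h0
    have h : ∏ c ∈ hs.toFinset, (u - PowerSeries.C c) = 0 := by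
      refine eq_zero_of_evalAt_eq_zero hI hπ hπ0 fun l => ?_
      rw [map_prod]
      refine Finset.prod_eq_zero (hs.mem_toFinset.2 (hu l)) ?_
      rw [map_sub, evalAt_C, sub_self]
    obtain ⟨c, -, hc⟩ := Finset.prod_eq_zero_iff.1 h
    rw [sub_eq_zero.1 hc, evalAt_C, evalAt_C]
  -- When `𝔪 = 0` there is only one point to evaluate at.
  · push Not at h0
    rw [Subtype.ext ((h0 l l.2).trans (h0 m m.2).symm)]

/-- A function on `(𝔪 ^ N)^(σ)` given by a power series and having finitely many values is
constant. -/
theorem eq_of_powerSeriesEvalsTo_of_finite [Finite σ] [IsDomain R]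
    [IsHausdorff (maximalIdeal R) R] (hI : IsAdic (maximalIdeal R)) {N : ℕ} (hN : 1 ≤ N)
    {F : MvPowerSeries σ R} {f : (σ → R) → R}
    (hf : ∀ z ∈ maxIdealPowBox R σ N, PowerSeriesEvalsTo F z (f z))
    (hfin : (f '' maxIdealPowBox R σ N).Finite) {z : σ → R} (hz : z ∈ maxIdealPowBox R σ N) :
    f z = f 0 := by
  classical
  obtain ⟨M, rfl⟩ : ∃ M, N = M + 1 := ⟨N - 1, by omega⟩
  have hsingle (i : σ) (y : R) (hy : y ∈ maximalIdeal R ^ (M + 1)) (z : σ → R)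
      (hz : z ∈ maxIdealPowBox R σ (M + 1)) :
      z + Pi.single i y ∈ maxIdealPowBox R σ (M + 1) := by
    intro j
    refine add_mem (hz j) ?_
    obtain rfl | hj := eq_or_ne j i
    · simpa using hy
    · simp [hj]
  have step (i : σ) (y : R) (hy : y ∈ maximalIdeal R ^ (M + 1)) :
      ∀ z ∈ maxIdealPowBox R σ (M + 1), f (z + Pi.single i y) = f z := by
    -- `𝔪 ^ (M + 1)` is additively generated by products `l * b` with `l ∈ 𝔪` and `b ∈ 𝔪 ^ M`. For
    -- fixed `b`, letting `l` run over all of `𝔪` gives a one-variable problem.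
    rw [pow_succ'] at hy
    refine (Submodule.mul_induction_on (C := fun y => y ∈ maximalIdeal R ^ (M + 1) ∧
      ∀ z ∈ maxIdealPowBox R σ (M + 1), f (z + Pi.single i y) = f z) hy ?_ ?_).2
    · intro a ha b hb
      have hmem (l) (hl : l ∈ maximalIdeal R) : l * b ∈ maximalIdeal R ^ (M + 1) := by
        rw [pow_succ']; exact Ideal.mul_mem_mul hl hb
      refine ⟨hmem a ha, fun z hz => ?_⟩
      -- The line through `z` in direction `b` along coordinate `i`; it passes through `z` at `l =
      -- 0` and reaches the required point at `l = a`.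
      let c : σ → PowerSeries R := fun j =>
        PowerSeries.C (z j) + PowerSeries.C ((Pi.single i b : σ → R) j) * PowerSeries.X
      have hc (j) : constantCoeff (c j) ∈ maximalIdeal R := by
        have : PowerSeries.constantCoeff (c j) = z j := by simp [c]
        exact this ▸ mem_maximalIdeal_of_mem_pow (by omega) (hz j)
      have hcl (l : maximalIdeal R) (j : σ) : PowerSeriesEvalsTo (c j) (fun _ : Unit => (l : R))
          ((z + Pi.single i (l * b) : σ → R) j) := by
        rw [powerSeriesEvalsTo_iff_evalAt hI, map_add, map_mul, evalAt_C, evalAt_C, evalAt_X,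
          Pi.add_apply]
        obtain rfl | hj := eq_or_ne j i
        · simp [mul_comm]
        · simp [hj]
      have key (l : maximalIdeal R) :
          evalAt hI l (aeval (R := R) (hasEval_of_constantCoeff_mem hI hc) F) =
            f (z + Pi.single i (l * b)) :=
        (powerSeriesEvalsTo_iff_evalAt hI l).1
          ((hf _ (hsingle i _ (hmem l l.2) z hz)).subst hI hc (fun _ => l.2) (hcl l))
      have := evalAt_eq_of_finite hI _ hfin (fun l => by
        rw [key l]
        exact Set.mem_image_of_mem _ (hsingle i _ (hmem l l.2) z hz)) ⟨a, ha⟩ 0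
      rw [key, key] at this
      simpa using this
    · rintro x y ⟨hx, hx'⟩ ⟨hy, hy'⟩
      refine ⟨add_mem hx hy, fun z hz => ?_⟩
      rw [Pi.single_add, ← add_assoc, hy' _ (hsingle i x hx z hz), hx' z hz]
  have := Fintype.ofFinite σ
  have hsum (s : Finset σ) : (∑ i ∈ s, Pi.single i (z i)) ∈ maxIdealPowBox R σ (M + 1) ∧
      f (∑ i ∈ s, Pi.single i (z i)) = f 0 := by
    induction s using Finset.induction_on with
    | empty => simpa using maxIdealPowBox_zero_mem σ (M + 1)
    | insert i s hi ih =>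
      rw [Finset.sum_insert hi, add_comm _ (Finset.sum _ _)]
      exact ⟨hsingle i _ (hz i) _ ih.1, by rw [step i _ (hz i) _ ih.1, ih.2]⟩
  have := (hsum Finset.univ).2
  rwa [Finset.univ_sum_single] at this

end PowerSeries

/-! ### The group of power series maps into a standard subgroup. -/

section StandardSubgroup

open MvPowerSeries IsLocalRing Filter
open scoped MvPowerSeries.WithPiTopology Topology

/-- The map `g` from `(𝔪 ^ L)^(τ)` to `G` takes values in `H` and is given by power series in the
coordinates `φ` of `H`. -/
structure IsPowerSeriesMap {R : Type*} [CommRing R] [IsLocalRing R] [TopologicalSpace R] {d : ℕ}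
    {G : Type*} [Group G] [TopologicalSpace G] (H : Subgroup G)
    (φ : OpenPartialHomeomorph G (Fin d → R)) {τ : Type*} {L : ℕ}
    (g : maxIdealPowBox R τ L → G) : Prop where
  mem : ∀ z, g z ∈ H
  exists_series : ∃ P : Fin d → MvPowerSeries τ R,
    ∀ z j, PowerSeriesEvalsTo (P j) z.1 (φ (g z) j)

theorem IsRStandardSubgroup.apply_mem {R : Type*} [CommRing R] [IsLocalRing R]
    [TopologicalSpace R] {d : ℕ} {G : Type*} [Group G] [TopologicalSpace G]
    [ChartedSpace (Fin d → R) G] {H : Subgroup G} {φ : OpenPartialHomeomorph G (Fin d → R)} {N : ℕ}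
    (hst : IsRStandardSubgroup H φ N) {x : G} (hx : x ∈ H) : φ x ∈ maxIdealPowBox R (Fin d) N :=
  hst.target_eq ▸ φ.map_source (hst.source_eq ▸ hx)

theorem IsRStandardSubgroup.t2Space {R : Type*} [CommRing R] [IsLocalRing R] [TopologicalSpace R]
    [T2Space R] {d : ℕ} {G : Type*} [Group G] [TopologicalSpace G] [IsTopologicalGroup G]
    [ChartedSpace (Fin d → R) G] {H : Subgroup G} {φ : OpenPartialHomeomorph G (Fin d → R)} {N : ℕ}
    (hst : IsRStandardSubgroup H φ N) : T2Space G := by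
  refine IsTopologicalGroup.t2Space_of_one_sep fun x hx => ?_
  have h1 : (1 : G) ∈ φ.source := hst.source_eq ▸ H.one_mem
  by_cases hxH : x ∈ φ.source
  · have hne : φ x ≠ φ 1 := fun h => hx (φ.injOn hxH h1 h)
    exact ⟨_, (φ.continuousAt h1).preimage_mem_nhds (isOpen_ne.mem_nhds hne.symm), by simp⟩
  · exact ⟨_, φ.open_source.mem_nhds h1, hxH⟩

variable {R : Type*} [CommRing R] [IsLocalRing R] [UniformSpace R] [IsUniformAddGroup R]
  [IsTopologicalRing R] [IsLinearTopology R R] [T2Space R] [CompleteSpace R]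
  {d : ℕ} {G : Type*} [Group G] [TopologicalSpace G] [ChartedSpace (Fin d → R) G]
  {H : Subgroup G} {φ : OpenPartialHomeomorph G (Fin d → R)} {N L : ℕ}
  {τ : Type*} {g g' : maxIdealPowBox R τ L → G}

instance : Zero (maxIdealPowBox R τ L) := ⟨⟨0, maxIdealPowBox_zero_mem τ L⟩⟩

omit [IsUniformAddGroup R] [IsTopologicalRing R] [IsLinearTopology R R] [T2Space R]
  [CompleteSpace R] in
theorem IsRStandardSubgroup.mem_maximalIdeal (hst : IsRStandardSubgroup H φ N) (hNL : N ≤ L)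
    (z : maxIdealPowBox R τ L) (i : τ) : z.1 i ∈ maximalIdeal R :=
  mem_maximalIdeal_of_mem_pow (hst.level_pos.trans hNL) (z.2 i)

theorem exists_series_subst [Finite τ] (hI : IsAdic (maximalIdeal R)) (hL : 1 ≤ L)
    {σ ι : Type*} [Finite σ]
    {f : maxIdealPowBox R τ L → σ → R} {P : σ → MvPowerSeries τ R}
    (hP : ∀ z i, PowerSeriesEvalsTo (P i) z.1 (f z i)) (hf : ∀ i, f 0 i ∈ maximalIdeal R)
    {y : maxIdealPowBox R τ L → ι → R} {F : ι → MvPowerSeries σ R}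
    (hF : ∀ z j, PowerSeriesEvalsTo (F j) (f z) (y z j)) :
    ∃ Q : ι → MvPowerSeries τ R, ∀ z j, PowerSeriesEvalsTo (Q j) z.1 (y z j) := by
  have hc (i) : constantCoeff (P i) ∈ maximalIdeal R := by
    rw [powerSeriesEvalsTo_zero_iff.1 (hP 0 i)]
    exact hf i
  exact ⟨_, fun z j => (hF z j).subst hI hc
    (fun i => mem_maximalIdeal_of_mem_pow hL (z.2 i)) (hP z)⟩

theorem IsPowerSeriesMap.mul [Finite τ] (hI : IsAdic (maximalIdeal R))
    (hst : IsRStandardSubgroup H φ N) (hNL : N ≤ L)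
    (hg : IsPowerSeriesMap H φ g) (hg' : IsPowerSeriesMap H φ g') :
    IsPowerSeriesMap H φ (g * g') := by
  obtain ⟨F, -, hF⟩ := hst.exists_mul_series
  obtain ⟨P, hP⟩ := hg.exists_series
  obtain ⟨P', hP'⟩ := hg'.exists_series
  refine ⟨fun z => H.mul_mem (hg.mem z) (hg'.mem z), ?_⟩
  refine exists_series_subst hI (hst.level_pos.trans hNL)
    (f := fun z => Sum.elim (φ (g z)) (φ (g' z))) (P := Sum.elim P P') ?_ ?_
    (fun z => hF _ (hg.mem z) _ (hg'.mem z))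
  · rintro z (i | i)
    · exact hP z i
    · exact hP' z i
  · rintro (i | i)
    · exact mem_maximalIdeal_of_mem_pow hst.level_pos (hst.apply_mem (hg.mem 0) i)
    · exact mem_maximalIdeal_of_mem_pow hst.level_pos (hst.apply_mem (hg'.mem 0) i)

theorem IsPowerSeriesMap.const [Finite τ] (hI : IsAdic (maximalIdeal R))
    (hst : IsRStandardSubgroup H φ N) (hNL : N ≤ L) {h : G} (hh : h ∈ H) :
    IsPowerSeriesMap H φ (fun _ : maxIdealPowBox R τ L => h) :=
  ⟨fun _ => hh, _, fun z j => powerSeriesEvalsTo_C hI (hst.mem_maximalIdeal hNL z) (φ h j)⟩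

/-- Constant terms in `𝔪 ^ N` are exactly what keeps the values in the image of `φ`. This presents
the power series maps as the image of a closed set of coefficient tuples. -/
theorem isPowerSeriesMap_eq_image [Finite τ] (hI : IsAdic (maximalIdeal R))
    (hst : IsRStandardSubgroup H φ N) (hNL : N ≤ L) :
    {g : maxIdealPowBox R τ L → G | IsPowerSeriesMap H φ g} =
      (fun (P : Fin d → MvPowerSeries τ R) (z : maxIdealPowBox R τ L) => φ.symm fun j => aeval (R := R)
        (hasEval_of_mem_maximalIdeal hI (hst.mem_maximalIdeal hNL z)) (P j)) ''
      {P | ∀ j, constantCoeff (P j) ∈ maximalIdeal R ^ N} := by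
  ext g
  constructor
  · rintro ⟨hgH, P, hP⟩
    refine ⟨P, fun j => ?_, funext fun z => ?_⟩
    · rw [powerSeriesEvalsTo_zero_iff.1 (hP 0 j)]
      exact hst.apply_mem (hgH 0) j
    · have : (fun j => aeval (R := R)
          (hasEval_of_mem_maximalIdeal hI (hst.mem_maximalIdeal hNL z)) (P j)) = φ (g z) :=
        funext fun j => (powerSeriesEvalsTo_iff _).1 (hP z j)
      simp only [this]
      exact φ.left_inv (hst.source_eq ▸ hgH z)
  · rintro ⟨P, hP, rfl⟩
    have hev (z : maxIdealPowBox R τ L) (j) := (powerSeriesEvalsTo_iff (F := P j)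
      (hasEval_of_mem_maximalIdeal hI (hst.mem_maximalIdeal hNL z))).2 rfl
    have ht (z : maxIdealPowBox R τ L) : (fun j => aeval (R := R)
        (hasEval_of_mem_maximalIdeal hI (hst.mem_maximalIdeal hNL z)) (P j)) ∈ φ.target := by
      rw [hst.target_eq]
      exact fun j => (hev z j).mem_pow hI (hP j) (maxIdealPowBox_anti hNL z.2)
    refine ⟨fun z => ?_, P, fun z j => ?_⟩
    · have := φ.map_target (ht z)
      rwa [hst.source_eq] at this
    · simp only [φ.right_inv (ht z)]
      exact hev z j

/-- Coefficient tuples form a compact space, and evaluation at each point is continuous in the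
coefficients. The image is therefore compact for pointwise convergence, hence closed. -/
theorem isClosed_isPowerSeriesMap [IsTopologicalGroup G] [CompactSpace R] [Finite τ]
    (hI : IsAdic (maximalIdeal R)) (hst : IsRStandardSubgroup H φ N) (hNL : N ≤ L) :
    IsClosed {g : maxIdealPowBox R τ L → G | IsPowerSeriesMap H φ g} := by
  have := hst.t2Space
  have : CompactSpace (MvPowerSeries τ R) := inferInstanceAs (CompactSpace ((τ →₀ ℕ) → R))
  have him := isPowerSeriesMap_eq_image (τ := τ) hI hst hNL
  rw [him]
  refine (IsCompact.image_of_continuousOn (IsClosed.isCompact ?_) ?_).isClosed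
  · simp only [Set.ofPred_forall]
    exact isClosed_iInter fun j => (isClosed_pow_of_isAdic hI N).preimage
      ((WithPiTopology.continuous_constantCoeff R).comp (continuous_apply j))
  · refine continuousOn_pi.2 fun z => φ.continuousOn_symm.comp (Continuous.continuousOn
      (continuous_pi fun j => (continuous_aeval _).comp (continuous_apply j))) fun P hP => ?_
    rw [hst.target_eq]
    exact fun j => ((powerSeriesEvalsTo_iff (hasEval_of_mem_maximalIdeal hI
      (hst.mem_maximalIdeal hNL z))).2 rfl).mem_pow hI (hP j) (maxIdealPowBox_anti hNL z.2)

/-- A standard subgroup comes with series for multiplication only. In the compact group of all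
functions from the box to `G`, `g⁻¹` is a cluster point of the powers `g ^ n`, which lie in a closed
set. -/
theorem IsPowerSeriesMap.inv [IsTopologicalGroup G] [CompactSpace G] [CompactSpace R] [Finite τ]
    (hI : IsAdic (maximalIdeal R)) (hst : IsRStandardSubgroup H φ N) (hNL : N ≤ L)
    (hg : IsPowerSeriesMap H φ g) : IsPowerSeriesMap H φ g⁻¹ := by
  have hpow (n : ℕ) : IsPowerSeriesMap H φ (g ^ n) := by
    induction n with
    | zero => exact pow_zero g ▸ IsPowerSeriesMap.const hI hst hNL H.one_mem
    | succ n ih => exact pow_succ g n ▸ ih.mul hI hst hNL hg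
  have hcl : MapClusterPt g⁻¹ atTop (g ^ · : ℕ → maxIdealPowBox R τ L → G) :=
    mapClusterPt_inv_atTop_pow.2 (by simpa using mapClusterPt_self_zpow_atTop_pow g 1)
  refine (isClosed_isPowerSeriesMap hI hst hNL).closure_subset
    (mem_closure_iff_clusterPt.2 (ClusterPt.mono hcl ?_))
  rw [le_principal_iff]
  exact mem_map.2 (Eventually.of_forall hpow)

omit [IsUniformAddGroup R] [IsTopologicalRing R] [IsLinearTopology R R] [CompleteSpace R]
  [ChartedSpace (Fin d → R) G] in
theorem IsPowerSeriesMap.mem_box (hI : IsAdic (maximalIdeal R)) (hg : IsPowerSeriesMap H φ g)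
    (h0 : φ (g 0) ∈ maxIdealPowBox R (Fin d) L) (z : maxIdealPowBox R τ L) :
    φ (g z) ∈ maxIdealPowBox R (Fin d) L := by
  obtain ⟨P, hP⟩ := hg.exists_series
  refine fun j => (hP z j).mem_pow hI ?_ z.2
  rw [powerSeriesEvalsTo_zero_iff.1 (hP 0 j)]
  exact h0 j

theorem IsPowerSeriesMap.eq_of_finite [IsDomain R] [IsHausdorff (maximalIdeal R) R] [Finite τ]
    (hI : IsAdic (maximalIdeal R)) (hst : IsRStandardSubgroup H φ N) (hNL : N ≤ L)
    (hg : IsPowerSeriesMap H φ g) (hfin : (Set.range g).Finite) (z : maxIdealPowBox R τ L) :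
    g z = g 0 := by
  classical
  obtain ⟨P, hP⟩ := hg.exists_series
  have hs (z) : g z ∈ φ.source := hst.source_eq ▸ hg.mem z
  refine φ.injOn (hs z) (hs 0) (funext fun j => ?_)
  have := eq_of_powerSeriesEvalsTo_of_finite hI (hst.level_pos.trans hNL)
    -- The value `0` off the box is a dummy: only values on the box matter.
    (F := P j) (f := fun z => if hz : z ∈ maxIdealPowBox R τ L then φ (g ⟨z, hz⟩) j else 0)
    (fun z hz => by simpa [hz] using hP ⟨z, hz⟩ j)
    ((hfin.image fun x => φ x j).subset ?_) z.2
  · simpa [maxIdealPowBox_zero_mem] using! this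
  · rintro _ ⟨z, hz, rfl⟩
    exact ⟨g ⟨z, hz⟩, Set.mem_range_self _, by simp [hz]⟩

end StandardSubgroup

/-! ### Word maps on cosets of `S`. -/

section Words

open MvPowerSeries IsLocalRing

/-- For `w = xy`, the quotient `w(t)⁻¹ w(ts)` is the conjugate of `x(t)⁻¹ x(ts)` by `y(t)`, times
`y(t)⁻¹ y(ts)`; induct on `w`. -/
theorem wordMap_mul_mem {k : ℕ} (w : FreeGroup (Fin k)) {G Z : Type*} [Group G]
    (A : Subgroup (Z → G)) (hA : ∀ g ∈ A, ∀ a : G, (fun z => a⁻¹ * g z * a) ∈ A)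
    (t : Fin k → G) (g : Fin k → Z → G) (hg : ∀ i, g i ∈ A) :
    (fun z => (wordMap w G t)⁻¹ * wordMap w G fun i => t i * g i z) ∈ A := by
  unfold wordMap
  induction w using FreeGroup.induction_on with
  | C1 =>
    simp only [_root_.map_one, inv_one, mul_one]
    exact A.one_mem
  | of i => simpa using hg i
  | inv_of i _ =>
    convert hA _ (A.inv_mem (hg i)) (t i)⁻¹ using 2 with z
    simp [mul_assoc]
  | mul x y hx hy =>
    convert A.mul_mem (hA _ hx (FreeGroup.lift t y)) hy using 2 with z
    simp [mul_assoc]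

theorem IsConstructedNormalStandard.wordMap_eq {R : Type*} [CommRing R] [IsDomain R]
    [IsLocalRing R] [UniformSpace R] [IsUniformAddGroup R] [IsTopologicalRing R]
    [IsLinearTopology R R] [T2Space R] [CompleteSpace R] [CompactSpace R]
    [IsHausdorff (maximalIdeal R) R] (hI : IsAdic (maximalIdeal R)) {d : ℕ} {G : Type*} [Group G]
    [TopologicalSpace G] [IsTopologicalGroup G] [CompactSpace G] [ChartedSpace (Fin d → R) G]
    {S : Subgroup G} (hS : IsConstructedNormalStandard R d S)
    {k : ℕ} {w : FreeGroup (Fin k)} (hw : (wordValues w G).Finite) :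
    S.Normal ∧ ∀ t s : Fin k → G, (∀ i, s i ∈ S) →
      wordMap w G (fun i => t i * s i) = wordMap w G t := by
  obtain ⟨H, φ, N, T, n, L, hst, hT, hn, ⟨⟨t₀, ht₀, rfl⟩, hL⟩, hSeq⟩ := hS
  set L := n t₀
  have hNL : N ≤ L := (hn t₀ ht₀).1
  have hmemS {x : G} : x ∈ S ↔ x ∈ H ∧ φ x ∈ maxIdealPowBox R (Fin d) L := by
    rw [← SetLike.mem_coe, hSeq]; rfl
  have conj {τ : Type} [Finite τ] {g : maxIdealPowBox R τ L → G} (hg : IsPowerSeriesMap H φ g)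
      (hgS : ∀ z, g z ∈ S) (a : G) : IsPowerSeriesMap H φ (fun z => a⁻¹ * g z * a) := by
    -- With `a = t * h`, conjugation by `t` is given by `C`, valid on `S` since `n t ≤ L`;
    -- conjugation by `h` is multiplication by constants inside `H`.
    obtain ⟨⟨⟨t, ht⟩, ⟨h, hh⟩⟩, rfl : t * h = a⟩ := hT.2 a
    obtain ⟨-, C, hC⟩ := hn t ht
    have hLt : n t ≤ L := hL ⟨t, ht, rfl⟩
    have hC' (z) := hC (g z) (hmemS.1 (hgS z)).1 (maxIdealPowBox_anti hLt (hmemS.1 (hgS z)).2)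
    obtain ⟨P, hP⟩ := hg.exists_series
    have h1 : IsPowerSeriesMap H φ (fun z => t⁻¹ * g z * t) :=
      ⟨fun z => (hC' z).1, exists_series_subst hI (hst.level_pos.trans hNL) hP
        (fun i => mem_maximalIdeal_of_mem_pow hst.level_pos (hst.apply_mem (hg.mem 0) i))
        fun z => (hC' z).2⟩
    convert ((IsPowerSeriesMap.const hI hst hNL (H.inv_mem hh)).mul hI hst hNL h1).mul hI hst hNL
      (IsPowerSeriesMap.const hI hst hNL hh) using 2 with z
    simp [mul_assoc]
  -- `e` selects `d` of the parameters: `id` parametrizes `S` itself, `Prod.mk i` the `i`-th of `k`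
  -- independent elements of `S`.
  have coord {τ : Type} [Finite τ] (e : Fin d → τ) :
      IsPowerSeriesMap H φ (fun z : maxIdealPowBox R τ L => φ.symm (z.1 ∘ e)) ∧
      ∀ z : maxIdealPowBox R τ L, φ.symm (z.1 ∘ e) ∈ S ∧ φ (φ.symm (z.1 ∘ e)) = z.1 ∘ e := by
    have hbox (z : maxIdealPowBox R τ L) : z.1 ∘ e ∈ maxIdealPowBox R (Fin d) L :=
      fun j => z.2 (e j)
    have ht (z : maxIdealPowBox R τ L) : z.1 ∘ e ∈ φ.target :=
      hst.target_eq ▸ maxIdealPowBox_anti hNL (hbox z)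
    have hH (z : maxIdealPowBox R τ L) : φ.symm (z.1 ∘ e) ∈ H := by
      have := φ.map_target (ht z)
      rwa [hst.source_eq] at this
    refine ⟨⟨hH, fun j => X (e j), fun z j => ?_⟩, fun z => ⟨hmemS.2 ⟨hH z, ?_⟩, ?_⟩⟩
    · rw [φ.right_inv (ht z)]
      exact powerSeriesEvalsTo_X hI (hst.mem_maximalIdeal hNL z) (e j)
    · rw [φ.right_inv (ht z)]
      exact hbox z
    · exact φ.right_inv (ht z)
  have hsymm0 : φ.symm 0 = 1 := by
    rw [← hst.map_one]
    exact φ.left_inv (hst.source_eq ▸ H.one_mem)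
  have hsymm (s : G) (hs : s ∈ S) : φ.symm (φ s) = s :=
    φ.left_inv (hst.source_eq ▸ (hmemS.1 hs).1)
  have hnorm : S.Normal := by
    refine ⟨fun s hs a => ?_⟩
    have h := coord (τ := Fin d) id
    have hc := conj h.1 (fun z => (h.2 z).1) a⁻¹
    -- Conjugation fixes `1`, so its series have zero constant term and preserve the box of level
    -- `L`.
    have h2 := hc.mem_box hI (by
      have : ((0 : maxIdealPowBox R (Fin d) L) : Fin d → R) ∘ id = 0 := rfl
      rw [this, hsymm0, mul_one, inv_mul_cancel, hst.map_one]
      exact maxIdealPowBox_zero_mem _ _) ⟨φ s, (hmemS.1 hs).2⟩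
    have h3 := hmemS.2 ⟨hc.mem _, h2⟩
    simpa [hsymm s hs] using h3
  refine ⟨hnorm, fun t s hs => ?_⟩
  let A : Subgroup (maxIdealPowBox R (Fin k × Fin d) L → G) :=
    { carrier := {g | IsPowerSeriesMap H φ g ∧ ∀ z, g z ∈ S}
      one_mem' := ⟨IsPowerSeriesMap.const hI hst hNL H.one_mem, fun _ => S.one_mem⟩
      mul_mem' := fun hg hg' =>
        ⟨hg.1.mul hI hst hNL hg'.1, fun z => S.mul_mem (hg.2 z) (hg'.2 z)⟩
      inv_mem' := fun hg => ⟨hg.1.inv hI hst hNL, fun z => S.inv_mem (hg.2 z)⟩ }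
  have hf := wordMap_mul_mem w A (fun g hg a => ⟨conj hg.1 hg.2 a, fun z => by
    simpa using hnorm.conj_mem _ (hg.2 z) a⁻¹⟩) t
    (fun i z => φ.symm (z.1 ∘ Prod.mk i)) fun i => ⟨(coord _).1, fun z => ((coord _).2 z).1⟩
  have heq := hf.1.eq_of_finite hI hst hNL
    ((hw.image fun x => (wordMap w G t)⁻¹ * x).subset (by
      rintro _ ⟨z, rfl⟩
      exact Set.mem_image_of_mem _ (Set.mem_range_self _)))
    ⟨fun p => φ (s p.1) p.2, fun p => (hmemS.1 (hs p.1)).2 p.2⟩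
  have e1 (i) : (fun p : Fin k × Fin d => φ (s p.1) p.2) ∘ Prod.mk i = φ (s i) := rfl
  have e0 (i : Fin k) :
    ((0 : maxIdealPowBox R (Fin k × Fin d) L) : Fin k × Fin d → R) ∘ Prod.mk i = 0 := rfl
  simp only [e1, e0, hsymm0, mul_one, hsymm _ (hs _)] at heq
  exact mul_left_cancel heq

theorem mainTheorem7 (p : ℕ) (R : Type*) [CommRing R] [IsLocalRing R] [TopologicalSpace R]
    [IsProPDomain p R] (d : ℕ) (G : Type*) [Group G] [TopologicalSpace G] [CompactSpace G]
    [ChartedSpace (Fin d → R) G] [RAnalyticGroup R d G]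
    (S : Subgroup G) (hS : IsConstructedNormalStandard R d S)
    (k : ℕ) (w : FreeGroup (Fin k)) (hw : (wordValues w G).Finite) :
    S ≤ marginalSubgroup w G ∧
    (∀ x y : Fin k → G, (∀ i, x i * (y i)⁻¹ ∈ S) → wordMap w G x = wordMap w G y) ∧
    (∀ t x y : Fin k → G, (∀ i, (t i)⁻¹ * x i ∈ S) → (∀ i, (t i)⁻¹ * y i ∈ S) →
      wordMap w G x = wordMap w G y) := by
  have hI : IsAdic (maximalIdeal R) := IsProPDomain.isAdic p
  have : IsDomain R := IsProPDomain.isDomain p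
  have : IsNoetherianRing R := IsProPDomain.isNoetherianRing p
  have : Finite (ResidueField R) := IsProPDomain.finite_residueField p
  have hcomp : IsAdicComplete (maximalIdeal R) R := IsProPDomain.isAdicComplete p
  have : IsTopologicalGroup G := RAnalyticGroup.isTopologicalGroup R d
  have : IsTopologicalRing R := isTopologicalRing_of_isAdic hI
  have : IsLinearTopology R R := isLinearTopology_of_isAdic hI
  let : UniformSpace R := IsTopologicalAddGroup.rightUniformSpace R
  have : IsUniformAddGroup R := isUniformAddGroup_of_addCommGroup
  obtain ⟨_, _⟩ := hI.isAdicComplete_iff.1 hcomp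
  have : CompactSpace R := compactSpace_of_isAdic hI
  obtain ⟨hnorm, h⟩ := hS.wordMap_eq hI hw
  have h1 (x y : Fin k → G) (hxy : ∀ i, x i * (y i)⁻¹ ∈ S) : wordMap w G x = wordMap w G y := by
    -- Normality turns `x i * (y i)⁻¹ ∈ S` into `(y i)⁻¹ * x i ∈ S`.
    have := h y (fun i => (y i)⁻¹ * x i) fun i => hnorm.mem_comm (hxy i)
    simpa using this
  refine ⟨fun s hs x i => h1 _ _ fun j => ?_, h1, fun t x y hx hy => ?_⟩
  · obtain rfl | hj := eq_or_ne j i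
    · simpa using hs
    · simp [hj, S.one_mem]
  · simpa using (h t _ hx).trans (h t _ hy).symm

end Words
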